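/- Let $\hbar>0$, and on $L^2(\mathbb R;\mathbb C)$ (inner product conjugate-linear in the first argument) let $x$ be the position operator $(x\psi)(x)=x\,\psi(x)$ with domain $\{\psi\in L^2: x\psi\in L^2\}$ and $p$ the momentum operator $p\psi=-i\hbar\psi'$ with domain $\{\psi\in L^2:\psi$ locally absolutely continuous, $\psi'\in L^2\}$. For $O\in\{x,p\}$ and a unit vector $\psi$ in the domain of $O$ let $\Delta O_\psi=\sqrt{\|O\psi\|^2-\langle\psi,O\psi\rangle^2}$. For a density operator $\rho$ (positive, trace one) with finite second moment of $O$, i.e. for which $\sqrt\rho$ maps into the domain of $O$ and $O\sqrt\rho$ is Hilbert–Schmidt, let $\Delta O_\rho=\sqrt{\operatorname{Tr}(O^2\rho)-\operatorname{Tr}(O\rho)^2}$, where $\operatorname{Tr}(O^2\rho)=\operatorname{Tr}\big((O\sqrt\rho)^*(O\sqrt\rho)\big)$ and $\operatorname{Tr}(O\rho)=\operatorname{Tr}(\sqrt\rho\,O\sqrt\rho)$. Let $R_p$ be the set of all $(\Delta x_\psi,\Delta p_\psi)$ for unit vectors $\psi$ and $R_m$ the set of all $(\Delta x_\rho,\Delta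 p_\rho)$ for density operators $\rho$ for which both standard deviations are defined. Then $$R_p=R_m=S:=\{(x,y)\in\mathbb R^2: xy\ge \hbar/2,\ x>0,\ y>0\}.$$ Moreover, every point of $S$ is attained by a freely evolved Gaussian wave packet: for every mass $m>0$, every $k_0\in\mathbb R$ and every $(x,y)\in S$ there are $a>0$, a solution $t\mapsto\psi_t\in L^2(\mathbb R)$, $t\in\mathbb R$, of the free Schrödinger equation $i\hbar\,\frac{d}{dt}\psi_t=\frac{p^2}{2m}\psi_t$ (with $\psi_t$ in the domain of $p^2$ and the derivative taken in $L^2$) with $$\psi_0(x)=\frac{1}{\sqrt{a\sqrt\pi}}\,e^{-\frac{x^2}{2a^2}+ik_0\frac{x}{a}},$$ and a time $t\ge 0$ such that $\|\psi_t\|=1$, $\psi_t$ lies in the domains of $x$ and $p$, and $(\Delta x_{\psi_t},\Delta p_{\psi_t})=(x,y)$. -/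

import Mathlib

open MeasureTheory

universe u

noncomputable section

namespace UncertaintyRegion

/-! ### Quantum states, observables and their uncertainties -/

section Abstract

variable {E : Type u} [NormedAddCommGroup E] [InnerProductSpace ℂ E]

/-- `HasTrace q c`: the sum of the diagonal entries `q e` over an orthonormal (Hilbert) basis
converges (absolutely) to `c`, for every such basis.  For `q φ = ⟪φ, T φ⟫` this says that
`T` has trace `c`. -/
def HasTrace (q : E → ℂ) (c : ℂ) : Prop :=
  ∀ (ι : Type u) (b : HilbertBasis ι ℂ E), HasSum (fun i => q (b i)) c

/-- Standard deviation of the (unbounded) observable `O` in a vector state `ψ ∈ D(O)`: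
`√(⟨ψ|O²|ψ⟩ - ⟨ψ|O|ψ⟩²)`, with `⟨ψ|O²|ψ⟩ = ‖Oψ‖²`. -/
def stdDev (O : E →ₗ.[ℂ] E) (ψ : O.domain) : ℝ :=
  √(‖O ψ‖ ^ 2 - (inner ℂ (ψ : E) (O ψ)).re ^ 2)

/-- The uncertainty region of a pair of observables for pure states: all pairs of standard
deviations in unit vectors for which both are finite. -/
def pureRegion (A B : E →ₗ.[ℂ] E) : Set (ℝ × ℝ) :=
  {v | ∃ ψ : E, ‖ψ‖ = 1 ∧ ∃ (hA : ψ ∈ A.domain) (hB : ψ ∈ B.domain),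
    v = (stdDev A ⟨ψ, hA⟩, stdDev B ⟨ψ, hB⟩)}

variable [CompleteSpace E]

/-- Density operators: positive operators of trace one. -/
def IsDensityOperator (ρ : E →L[ℂ] E) : Prop :=
  ρ.IsPositive ∧ HasTrace (fun φ => inner ℂ φ (ρ φ)) 1

/-- `HasStdDev O ρ s`: the (unbounded) observable `O` has finite second moment in the mixed
state `ρ`, and its standard deviation `√(Tr(O²ρ) - Tr(Oρ)²)` is `s`.  As usual for unbounded
`O`, `Tr(O²ρ)` means `Tr((O√ρ)⋆(O√ρ))` and `Tr(Oρ)` means `Tr(√ρ O √ρ)`. -/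
def HasStdDev (O : E →ₗ.[ℂ] E) (ρ : E →L[ℂ] E) (s : ℝ) : Prop :=
  ∃ h : ∀ φ : E, CFC.sqrt ρ φ ∈ O.domain, ∃ q m : ℝ,
    HasTrace (fun φ => inner ℂ (O ⟨CFC.sqrt ρ φ, h φ⟩) (O ⟨CFC.sqrt ρ φ, h φ⟩)) q ∧
    HasTrace (fun φ => inner ℂ (CFC.sqrt ρ φ) (O ⟨CFC.sqrt ρ φ, h φ⟩)) m ∧
    s = √(q - m ^ 2)

/-- The uncertainty region of a pair of observables for mixed states. -/
def mixedRegion (A B : E →ₗ.[ℂ] E) : Set (ℝ × ℝ) :=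
  {v | ∃ ρ : E →L[ℂ] E, IsDensityOperator ρ ∧ HasStdDev A ρ v.1 ∧ HasStdDev B ρ v.2}

end Abstract

/-! ### Position and momentum of a particle on the line -/

/-- The state space `L²(ℝ; ℂ)`. -/
abbrev L2 : Type := Lp ℂ 2 (volume : Measure ℝ)

/-- The position operator `(xψ)(x) = x ψ(x)` on `{ψ ∈ L² : xψ ∈ L²}`. -/
def position : L2 →ₗ.[ℂ] L2 where
  domain :=
    { carrier := {ψ | MemLp (fun x : ℝ => (x : ℂ) * ψ x) 2 volume}
      add_mem' := by
        intro f g hf hg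
        refine (hf.add hg).ae_eq ?_
        filter_upwards [Lp.coeFn_add f g] with x hx
        simp only [hx, Pi.add_apply, mul_add]
      zero_mem' := by
        refine (MemLp.zero (ε := ℂ)).ae_eq ?_
        filter_upwards [Lp.coeFn_zero ℂ 2 (volume : Measure ℝ)] with x _
        simp
      smul_mem' := by
        intro c f hf
        refine (hf.const_smul c).ae_eq ?_
        filter_upwards [Lp.coeFn_smul c f] with x hx
        simp only [hx, Pi.smul_apply, smul_eq_mul]
        ring }
  toFun :=
    { toFun := fun ψ => MemLp.toLp (fun x : ℝ => (x : ℂ) * (ψ : L2) x) ψ.2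
      map_add' := by
        intro f g
        rw [← MemLp.toLp_add, MemLp.toLp_eq_toLp_iff]
        filter_upwards [Lp.coeFn_add (f : L2) (g : L2)] with x hx
        simp only [Submodule.coe_add, hx, Pi.add_apply, mul_add]
      map_smul' := by
        intro c f
        rw [RingHom.id_apply, ← MemLp.toLp_const_smul, MemLp.toLp_eq_toLp_iff]
        filter_upwards [Lp.coeFn_smul c (f : L2)] with x hx
        simp only [Submodule.coe_smul, hx, Pi.smul_apply, smul_eq_mul]
        ring }

/-- `HasL2Deriv f g`: `f` has a locally absolutely continuous representative whose almost
everywhere derivative is `g`. -/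
def HasL2Deriv (f g : L2) : Prop :=
  ∃ c : ℂ, ∀ᵐ x : ℝ, f x = c + ∫ t in (0 : ℝ)..x, g t

lemma L2.intervalIntegrable (f : L2) (a b : ℝ) : IntervalIntegrable f volume a b :=
  intervalIntegrable_iff.2 (((((Lp.memLp f).locallyIntegrable (by norm_num)).integrableOn_isCompact
    isCompact_uIcc)).mono_set Set.uIoc_subset_uIcc)

lemma HasL2Deriv.add {f g f' g' : L2} (h : HasL2Deriv f f') (k : HasL2Deriv g g') :
    HasL2Deriv (f + g) (f' + g') := by
  obtain ⟨c, hc⟩ := h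
  obtain ⟨d, hd⟩ := k
  refine ⟨c + d, ?_⟩
  filter_upwards [hc, hd, Lp.coeFn_add f g] with x h1 h2 h3
  have h4 : ∫ t in (0 : ℝ)..x, (f' + g' : L2) t = ∫ t in (0 : ℝ)..x, (f' t + g' t) :=
    intervalIntegral.integral_congr_ae (by
      filter_upwards [Lp.coeFn_add f' g'] with t ht _
      simpa using ht)
  rw [h3, Pi.add_apply, h1, h2, h4, intervalIntegral.integral_add
    (f'.intervalIntegrable 0 x) (g'.intervalIntegrable 0 x)]
  ring

lemma HasL2Deriv.smul {f f' : L2} (c : ℂ) (h : HasL2Deriv f f') :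
    HasL2Deriv (c • f) (c • f') := by
  obtain ⟨d, hd⟩ := h
  refine ⟨c * d, ?_⟩
  filter_upwards [hd, Lp.coeFn_smul c f] with x h1 h3
  have h4 : ∫ t in (0 : ℝ)..x, (c • f' : L2) t = ∫ t in (0 : ℝ)..x, c * f' t :=
    intervalIntegral.integral_congr_ae (by
      filter_upwards [Lp.coeFn_smul c f'] with t ht _
      simpa using ht)
  rw [h3, Pi.smul_apply, h1, h4, intervalIntegral.integral_const_mul, smul_eq_mul]
  ring

lemma hasL2Deriv_zero : HasL2Deriv 0 0 := by
  refine ⟨0, ?_⟩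
  filter_upwards [Lp.coeFn_zero ℂ 2 (volume : Measure ℝ)] with x hx
  have h4 : ∫ t in (0 : ℝ)..x, (0 : L2) t = ∫ t in (0 : ℝ)..x, (0 : ℂ) :=
    intervalIntegral.integral_congr_ae (by
      filter_upwards [Lp.coeFn_zero ℂ 2 (volume : Measure ℝ)] with t _ _
      simp)
  rw [hx, h4]
  simp

/-- The derivative of an `L²` function is unique. -/
lemma HasL2Deriv.unique {f g h : L2} (hg : HasL2Deriv f g) (hh : HasL2Deriv f h) : g = h := by
  obtain ⟨c, hc⟩ := hg
  obtain ⟨d, hd⟩ := hh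
  have lg : LocallyIntegrable g volume := (Lp.memLp g).locallyIntegrable (by norm_num)
  have lh : LocallyIntegrable h volume := (Lp.memLp h).locallyIntegrable (by norm_num)
  have cg : Continuous fun x : ℝ => c + ∫ t in (0 : ℝ)..x, g t :=
    continuous_const.add (intervalIntegral.continuous_primitive (g.intervalIntegrable) 0)
  have ch : Continuous fun x : ℝ => d + ∫ t in (0 : ℝ)..x, h t :=
    continuous_const.add (intervalIntegral.continuous_primitive (h.intervalIntegrable) 0)
  have key : (fun x : ℝ => c + ∫ t in (0 : ℝ)..x, g t) =
      fun x : ℝ => d + ∫ t in (0 : ℝ)..x, h t := by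
    refine Continuous.ae_eq_iff_eq volume cg ch |>.1 ?_
    filter_upwards [hc, hd] with x h1 h2
    rw [← h1, ← h2]
  apply Lp.ext
  filter_upwards [_root_.LocallyIntegrable.ae_hasDerivAt_integral lg,
    _root_.LocallyIntegrable.ae_hasDerivAt_integral lh] with x h1 h2
  have h3 := (h1 0).const_add c
  have h4 := (h2 0).const_add d
  exact h3.unique (key ▸ h4)

/-- The momentum operator `pψ = -iħ ψ'` on the absolutely continuous `ψ ∈ L²` with
`ψ' ∈ L²`. -/
def momentum (ħ : ℝ) : L2 →ₗ.[ℂ] L2 where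
  domain :=
    { carrier := {ψ | ∃ g : L2, HasL2Deriv ψ g}
      add_mem' := fun ⟨_, hf⟩ ⟨_, hg⟩ => ⟨_, hf.add hg⟩
      zero_mem' := ⟨0, hasL2Deriv_zero⟩
      smul_mem' := fun c _ ⟨_, hf⟩ => ⟨_, hf.smul c⟩ }
  toFun :=
    { toFun := fun ψ => (-(Complex.I * ħ)) • ψ.2.choose
      map_add' := by
        intro f g
        rw [← smul_add]
        congr 1
        exact (f + g).2.choose_spec.unique (f.2.choose_spec.add g.2.choose_spec)
      map_smul' := by
        intro c f
        rw [RingHom.id_apply, smul_comm c]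
        congr 1
        exact (c • f).2.choose_spec.unique (f.2.choose_spec.smul c) }

/-! ### Free time evolution -/

/-- `u : ℝ → L²` solves the free Schrödinger equation `iħ ∂u/∂t = (p²/2m) u` of a particle of
mass `m`: at each time `u t` lies in the domain of `p²` and the `L²`-derivative of `u` is
`(iħ)⁻¹ (2m)⁻¹ p² u(t)`. -/
def IsFreeEvolution (ħ m : ℝ) (u : ℝ → L2) : Prop :=
  ∀ t : ℝ, ∃ (h₁ : u t ∈ (momentum ħ).domain)
    (h₂ : momentum ħ ⟨u t, h₁⟩ ∈ (momentum ħ).domain),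
    HasDerivAt u ((Complex.I * ħ)⁻¹ • ((2 * m : ℂ)⁻¹ • momentum ħ ⟨momentum ħ ⟨u t, h₁⟩, h₂⟩)) t

/-- The Gaussian wave packet of width `a` and (dimensionless) wave number `k₀`. -/
def gaussianPacket (a k₀ : ℝ) (x : ℝ) : ℂ :=
  (1 / √(a * √Real.pi) : ℝ) *
    Complex.exp (-((x : ℂ) ^ 2 / (2 * (a : ℂ) ^ 2)) + Complex.I * k₀ * (x / a))

/-- The hyperbolic region `{(x, y) : xy ≥ ħ/2, x, y > 0}`. -/
def hyperbolicRegion (ħ : ℝ) : Set (ℝ × ℝ) :=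
  {v | ħ / 2 ≤ v.1 * v.2 ∧ 0 < v.1 ∧ 0 < v.2}

end UncertaintyRegion

end

namespace UncertaintyRegion

open Filter Topology

/-! ### The uncertainty relation -/

/-! The proof closes a cycle of inclusions: pure ⊆ mixed ⊆ hyperbolic ⊆ pure.

A pure state is a rank-one projection, which is its own square root, so all its traces reduce to
Parseval (`pureRegion_subset_mixedRegion`).

For mixed states, expand 0 ≤ ‖l(x - a)ψ + i(p - b)ψ‖². The cross term is the commutator, needed only
in the weak form Re⟨xψ, ψ'⟩ = -‖ψ‖²/2, the integral of (x|ψ|²)'. The resulting inequality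
`uncertainty_quadratic` needs no normalisation of ψ, so it can be applied to every √ρ eᵢ and summed
over a Hilbert basis. With a and b the means, the sums are the variances V and W, and Vl² - ħl + W ≥
0 for all real l forces ħ² ≤ 4VW.

For the last inclusion, inserting exp(α + βx + γx²) into the Schrödinger equation gives a Riccati
system, solved through w(t) = a² + iħt/m. Then Δp = ħ/(√2 a) at all times, while Δx² = |w|²/(2a²)
increases from a²/2 to infinity for t ≥ 0. Hence y fixes a and x fixes t (`exists_packet`). -/

/-- Integrability of f gives F limits at both ends, and integrability of F forces these limits to be
0. -/
theorem integral_eq_zero_of_integrable_primitive {F f : ℝ → ℝ} (hF : Integrable F)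
    (hf : Integrable f) (h : ∀ b, ∫ t in (0 : ℝ)..b, f t = F b - F 0) : ∫ x, f x = 0 := by
  have h₁ : Tendsto F atTop (𝓝 (F 0 + ∫ x in Set.Ioi (0 : ℝ), f x)) := by
    have := (intervalIntegral_tendsto_integral_Ioi 0 hf.integrableOn tendsto_id).const_add (F 0)
    refine this.congr fun b => ?_
    simp only [id, h]; ring
  have h₂ : Tendsto F atBot (𝓝 (F 0 - ∫ x in Set.Iic (0 : ℝ), f x)) := by
    have := (intervalIntegral_tendsto_integral_Iic 0 hf.integrableOn tendsto_id).const_sub (F 0)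
    refine this.congr fun b => ?_
    simp only [id]
    rw [intervalIntegral.integral_symm, h]; ring
  have e₁ : F 0 + ∫ x in Set.Ioi (0 : ℝ), f x = 0 := by
    refine IntegrableAtFilter.eq_zero_of_tendsto (μ := volume) (l := atTop)
      ⟨Set.univ, univ_mem, hF.integrableOn⟩ (fun s hs => ?_) h₁
    obtain ⟨b, hb⟩ := mem_atTop_sets.1 hs
    rw [← top_le_iff, ← Real.volume_Ici (a := b)]
    exact measure_mono hb
  have e₂ : F 0 - ∫ x in Set.Iic (0 : ℝ), f x = 0 := by
    refine IntegrableAtFilter.eq_zero_of_tendsto (μ := volume) (l := atBot)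
      ⟨Set.univ, univ_mem, hF.integrableOn⟩ (fun s hs => ?_) h₂
    obtain ⟨b, hb⟩ := mem_atBot_sets.1 hs
    rw [← top_le_iff, ← Real.volume_Iic (a := b)]
    exact measure_mono hb
  rw [← intervalIntegral.integral_Iic_add_Ioi hf.integrableOn hf.integrableOn]
  linarith

theorem _root_.MeasureTheory.MemLp.integrable_real_inner {f g : ℝ → ℂ} (hf : MemLp f 2 volume)
    (hg : MemLp g 2 volume) : Integrable (fun x => inner ℝ (f x) (g x)) := by
  refine (L2.integrable_inner (𝕜 := ℝ) hf.toLp hg.toLp).congr ?_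
  filter_upwards [hf.coeFn_toLp, hg.coeFn_toLp] with x h₁ h₂
  rw [h₁, h₂]

/-- The integrand is the derivative of (rx + s)|ψ|², which is integrable together with its
derivative. Weight 1 yields Re⟨ψ, ψ'⟩ = 0 (symmetry of p), weight x yields the commutation relation.
-/
theorem integral_affine_mul_normSq_deriv {ψ g : L2} (h : HasL2Deriv ψ g) (r s : ℝ)
    (hφ : MemLp (fun x : ℝ => ((r * x + s : ℝ) : ℂ) * ψ x) 2) :
    ∫ x, (r * ‖ψ x‖ ^ 2 + 2 * inner ℝ (((r * x + s : ℝ) : ℂ) * ψ x) (g x)) = 0 := by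
  obtain ⟨c, hc⟩ := h
  set Ψ : ℝ → ℂ := fun x => c + ∫ t in (0 : ℝ)..x, g t with hΨ
  set φ : ℝ → ℂ := fun x => ((r * x + s : ℝ) : ℂ) * ψ x with hφd
  -- Absolute continuity is proved for the real and imaginary parts of Ψ, since |Ψ|² is the sum of
  -- their squares.
  have hi := g.intervalIntegrable
  have acre : ∀ b, AbsolutelyContinuousOnInterval (fun x => (Ψ x).re) 0 b := by
    intro b
    have h1 : IntervalIntegrable (fun t => (g t).re) volume 0 b :=
      ⟨(hi 0 b).1.re, (hi 0 b).2.re⟩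
    have h2 := (h1.absolutelyContinuousOnInterval_intervalIntegral (c := 0) (by simp)).add
      (contDiff_const (c := c.re) (n := 1)).contDiffOn.absolutelyContinuousOnInterval
    refine (congrArg (AbsolutelyContinuousOnInterval · 0 b) (funext fun x => ?_)).mp h2
    have := Complex.reCLM.intervalIntegral_comp_comm (hi 0 x)
    simp only [Complex.reCLM_apply] at this
    simp [hΨ, this, add_comm]
  have acim : ∀ b, AbsolutelyContinuousOnInterval (fun x => (Ψ x).im) 0 b := by
    intro b
    have h1 : IntervalIntegrable (fun t => (g t).im) volume 0 b :=
      ⟨(hi 0 b).1.im, (hi 0 b).2.im⟩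
    have h2 := (h1.absolutelyContinuousOnInterval_intervalIntegral (c := 0) (by simp)).add
      (contDiff_const (c := c.im) (n := 1)).contDiffOn.absolutelyContinuousOnInterval
    refine (congrArg (AbsolutelyContinuousOnInterval · 0 b) (funext fun x => ?_)).mp h2
    have := Complex.imCLM.intervalIntegral_comp_comm (hi 0 x)
    simp only [Complex.imCLM_apply] at this
    simp [hΨ, this, add_comm]
  set F : ℝ → ℝ := fun x => (r * x + s) * ‖Ψ x‖ ^ 2 with hF
  have acF : ∀ b, AbsolutelyContinuousOnInterval F 0 b := by
    intro b
    have h0 : AbsolutelyContinuousOnInterval (fun x : ℝ => r * x + s) 0 b :=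
      (show ContDiff ℝ 1 (fun x : ℝ => r * x + s) by fun_prop).contDiffOn
        |>.absolutelyContinuousOnInterval
    have := h0.mul (((acre b).mul (acre b)).add ((acim b).mul (acim b)))
    convert this using 1
    ext x
    simp [hF, ← Complex.normSq_eq_norm_sq, Complex.normSq_apply]
  have hd : ∀ᵐ x, HasDerivAt Ψ (g x) x := by
    have lg : LocallyIntegrable g volume := (Lp.memLp g).locallyIntegrable (by norm_num)
    filter_upwards [_root_.LocallyIntegrable.ae_hasDerivAt_integral lg] with x hx
    exact (hx 0).const_add c
  have hdF : ∀ᵐ x, deriv F x = r * ‖ψ x‖ ^ 2 + 2 * inner ℝ (φ x) (g x) := by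
    filter_upwards [hd, hc] with x hx hcx
    have h1 := (((hasDerivAt_id x).const_mul r).add_const s).mul hx.norm_sq
    have h2 : deriv F x = _ := h1.deriv
    rw [h2, hφd]
    change _ = _ + 2 * inner ℝ (((r * x + s : ℝ) : ℂ) * ψ x) (g x)
    have h3 : Ψ x = ψ x := hcx.symm
    rw [h3, ← Complex.real_smul, real_inner_smul_left]
    simp; ring
  have i1 : Integrable (fun x => ‖ψ x‖ ^ 2) := by
    have := (Lp.memLp ψ).integrable_norm_rpow (by norm_num) (by norm_num)
    simpa using this
  have i2 : Integrable (fun x => inner ℝ (φ x) (g x)) := hφ.integrable_real_inner (Lp.memLp g)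
  have i3 : Integrable (fun x => inner ℝ (φ x) (ψ x)) := hφ.integrable_real_inner (Lp.memLp ψ)
  refine integral_eq_zero_of_integrable_primitive (F := F) ?_
    ((i1.const_mul r).add (i2.const_mul 2)) fun b => ?_
  · refine i3.congr ?_
    filter_upwards [hc] with x hx
    have h3 : Ψ x = ψ x := hx.symm
    rw [hF]
    change _ = (r * x + s) * ‖Ψ x‖ ^ 2
    rw [h3, hφd]
    change inner ℝ (((r * x + s : ℝ) : ℂ) * ψ x) (ψ x) = _
    rw [← Complex.real_smul, real_inner_smul_left, real_inner_self_eq_norm_sq]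
  · rw [← (acF b).integral_deriv_eq_sub]
    refine intervalIntegral.integral_congr_ae ?_
    filter_upwards [hdF] with x hx _ using hx.symm

theorem L2.re_inner (f g : L2) : (inner ℂ f g).re = ∫ x, inner ℝ (f x) (g x) := by
  rw [L2.inner_def]
  have h : Integrable (fun x => inner ℂ (f x) (g x)) := L2.integrable_inner f g
  exact (integral_re h).symm

theorem L2.norm_sq_eq_integral (f : L2) : ‖f‖ ^ 2 = ∫ x, ‖f x‖ ^ 2 := by
  rw [← inner_self_eq_norm_sq (𝕜 := ℂ) f]
  refine (L2.re_inner f f).trans ?_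
  simp_rw [real_inner_self_eq_norm_sq]

theorem position_coeFn {ψ : L2} (h : ψ ∈ position.domain) :
    position ⟨ψ, h⟩ =ᵐ[volume] fun x : ℝ => (x : ℂ) * ψ x :=
  MemLp.coeFn_toLp (f := fun x : ℝ => (x : ℂ) * ψ x) h

theorem momentum_apply {ħ : ℝ} {ψ g : L2} (hg : HasL2Deriv ψ g)
    (h : ψ ∈ (momentum ħ).domain) : momentum ħ ⟨ψ, h⟩ = (-(Complex.I * ħ)) • g :=
  congrArg ((-(Complex.I * ħ : ℂ)) • ·) (HasL2Deriv.unique h.choose_spec hg)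

theorem re_inner_deriv_self {ψ g : L2} (h : HasL2Deriv ψ g) : (inner ℂ ψ g).re = 0 := by
  have := integral_affine_mul_normSq_deriv h 0 1 (by simpa using Lp.memLp ψ)
  rw [L2.re_inner]
  simpa [integral_const_mul] using this

/-- The weak form of [x, p] = iħ: ψ need not lie in the domain of xp or px. -/
theorem re_inner_position_deriv {ψ g : L2} (hx : ψ ∈ position.domain) (h : HasL2Deriv ψ g) :
    (inner ℂ (position ⟨ψ, hx⟩) g).re = -(‖ψ‖ ^ 2 / 2) := by
  have hx' : MemLp (fun x : ℝ => (x : ℂ) * ψ x) 2 volume := hx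
  have := integral_affine_mul_normSq_deriv h 1 0 (by simpa using hx')
  have i1 : Integrable (fun x => ‖ψ x‖ ^ 2) := by
    simpa using (Lp.memLp ψ).integrable_norm_rpow (by norm_num) (by norm_num)
  have i2 : Integrable (fun x : ℝ => inner ℝ ((x : ℂ) * ψ x) (g x)) :=
    hx'.integrable_real_inner (Lp.memLp g)
  have e : (inner ℂ (position ⟨ψ, hx⟩) g).re = ∫ x : ℝ, inner ℝ ((x : ℂ) * ψ x) (g x) := by
    rw [L2.re_inner]
    refine integral_congr_ae ?_
    filter_upwards [position_coeFn hx] with x hx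
    rw [hx]
  simp only [one_mul, add_zero] at this
  rw [integral_add i1 (i2.const_mul 2), integral_const_mul, ← L2.norm_sq_eq_integral, ← e] at this
  linarith

theorem im_inner_position {ψ : L2} (hx : ψ ∈ position.domain) :
    (inner ℂ ψ (position ⟨ψ, hx⟩)).im = 0 := by
  rw [L2.inner_def]
  have h : Integrable (fun x => inner ℂ (ψ x) (position ⟨ψ, hx⟩ x)) := L2.integrable_inner _ _
  refine (integral_im h).symm.trans ?_
  refine integral_eq_zero_of_ae ?_
  filter_upwards [position_coeFn hx] with x hx
  rw [hx]
  simp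
  ring

theorem im_inner_momentum {ħ : ℝ} {ψ : L2} (hp : ψ ∈ (momentum ħ).domain) :
    (inner ℂ ψ (momentum ħ ⟨ψ, hp⟩)).im = 0 := by
  obtain ⟨g, hg⟩ := id hp
  rw [momentum_apply hg, inner_smul_right]
  simp [re_inner_deriv_self hg]

theorem norm_sub_real_smul_sq {E : Type*} [NormedAddCommGroup E] [InnerProductSpace ℂ E]
    (ψ φ : E) (a : ℝ) :
    ‖φ - (a : ℂ) • ψ‖ ^ 2 = ‖φ‖ ^ 2 - 2 * a * (inner ℂ ψ φ).re + a ^ 2 * ‖ψ‖ ^ 2 := by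
  have h := norm_sub_sq (𝕜 := ℂ) φ ((a : ℂ) • ψ)
  have e : (inner ℂ φ ψ).re = (inner ℂ ψ φ).re := by
    rw [← inner_conj_symm, Complex.conj_re]
  rw [h, inner_smul_right, norm_smul]
  simp [mul_pow, e]
  ring

/-- The quadratic form of the uncertainty relation. -/
theorem uncertainty_quadratic {ħ : ℝ} {ψ : L2} (hx : ψ ∈ position.domain)
    (hp : ψ ∈ (momentum ħ).domain) (a b l : ℝ) :
    l * ħ * ‖ψ‖ ^ 2 ≤ l ^ 2 * ‖position ⟨ψ, hx⟩ - (a : ℂ) • ψ‖ ^ 2 +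
      ‖momentum ħ ⟨ψ, hp⟩ - (b : ℂ) • ψ‖ ^ 2 := by
  obtain ⟨g, hg⟩ := id hp
  have e₁ := re_inner_deriv_self hg
  have e₂ := re_inner_position_deriv hx hg
  have e₃ := im_inner_position hx
  rw [momentum_apply hg]
  set X := position ⟨ψ, hx⟩
  have key := sq_nonneg ‖(l : ℂ) • (X - (a : ℂ) • ψ) +
    Complex.I • ((-(Complex.I * ħ)) • g - (b : ℂ) • ψ)‖
  have h := norm_add_sq (𝕜 := ℂ) ((l : ℂ) • (X - (a : ℂ) • ψ))
    (Complex.I • ((-(Complex.I * ħ)) • g - (b : ℂ) • ψ))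
  rw [h, norm_smul, norm_smul, mul_pow, mul_pow] at key
  have e₄ : (inner ℂ X ψ).im = 0 := by
    rw [← inner_conj_symm, Complex.conj_im, e₃, neg_zero]
  -- The shifts a and b drop out because ⟨ψ, xψ⟩ is real and Re⟨ψ, ψ'⟩ = 0; only the commutator
  -- survives.
  have e₅ : RCLike.re (inner ℂ ((l : ℂ) • (X - (a : ℂ) • ψ))
      (Complex.I • ((-(Complex.I * ħ)) • g - (b : ℂ) • ψ))) = -(l * ħ * (‖ψ‖ ^ 2 / 2)) := by
    have e₆ : (inner ℂ ψ ψ).im = 0 := inner_self_im (𝕜 := ℂ) ψ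
    simp only [inner_smul_left, inner_smul_right, inner_sub_left, inner_sub_right]
    simp [-inner_self_eq_norm_sq_to_K, e₁, e₂, e₄, e₆]
    ring
  rw [e₅, Complex.norm_I, Complex.norm_real, Real.norm_eq_abs, sq_abs] at key
  linarith

/-! ### Rank-one states and traces of density operators -/

section

variable {E : Type u} [NormedAddCommGroup E] [InnerProductSpace ℂ E]

/-- Parseval. Every trace of a pure state has this form, with c = 1, ‖Oψ‖² or ⟨ψ, Oψ⟩. -/
theorem hasTrace_rankOne {ψ : E} (hψ : ‖ψ‖ = 1) (c : ℂ) :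
    HasTrace (fun φ : E => inner ℂ φ ψ * inner ℂ ψ φ * c) c := by
  intro ι b
  have h := (b.hasSum_inner_mul_inner ψ ψ).mul_right c
  rw [inner_self_eq_norm_sq_to_K, hψ] at h
  simpa [mul_comm (inner ℂ ψ _)] using h

theorem HasTrace.re_hasSum {q : E → ℂ} {c : ℂ} (h : HasTrace q c) {ι : Type u}
    (b : HilbertBasis ι ℂ E) : HasSum (fun i => (q (b i)).re) c.re :=
  Complex.hasSum_re (h ι b)

theorem isDensityOperator_rankOne {ψ : E} (hψ : ‖ψ‖ = 1) :
    IsDensityOperator (InnerProductSpace.rankOne ℂ ψ ψ) := by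
  refine ⟨InnerProductSpace.isPositive_rankOne_self ψ, ?_⟩
  convert hasTrace_rankOne hψ 1 using 2 with φ
  simp [mul_comm]

variable [CompleteSpace E]

theorem sqrt_rankOne_self {ψ : E} (hψ : ‖ψ‖ = 1) :
    CFC.sqrt (InnerProductSpace.rankOne ℂ ψ ψ) = InnerProductSpace.rankOne ℂ ψ ψ :=
  CFC.sqrt_unique (InnerProductSpace.isIdempotentElem_rankOne_self hψ)
    ((ContinuousLinearMap.nonneg_iff_isPositive _).2
      (InnerProductSpace.isPositive_rankOne_self ψ))

theorem hasStdDev_rankOne {O : E →ₗ.[ℂ] E} {ψ : E} (hψ : ‖ψ‖ = 1) (h : ψ ∈ O.domain)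
    (hre : (inner ℂ ψ (O ⟨ψ, h⟩)).im = 0) :
    HasStdDev O (InnerProductSpace.rankOne ℂ ψ ψ) (stdDev O ⟨ψ, h⟩) := by
  have hs : ∀ φ : E, CFC.sqrt (InnerProductSpace.rankOne ℂ ψ ψ) φ = inner ℂ ψ φ • ψ := by
    intro φ
    rw [sqrt_rankOne_self hψ, InnerProductSpace.rankOne_apply]
  have hd : ∀ φ : E, CFC.sqrt (InnerProductSpace.rankOne ℂ ψ ψ) φ ∈ O.domain := fun φ => by
    rw [hs]; exact O.domain.smul_mem _ h
  have hO : ∀ φ : E, O ⟨CFC.sqrt (InnerProductSpace.rankOne ℂ ψ ψ) φ, hd φ⟩ =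
      inner ℂ ψ φ • O ⟨ψ, h⟩ := by
    intro φ
    rw [← LinearPMap.map_smul]
    congr 1
    exact Subtype.ext (hs φ)
  refine ⟨hd, ‖O ⟨ψ, h⟩‖ ^ 2, (inner ℂ ψ (O ⟨ψ, h⟩)).re, ?_, ?_, rfl⟩
  · convert hasTrace_rankOne hψ (((‖O ⟨ψ, h⟩‖ ^ 2 : ℝ) : ℂ)) using 2 with φ
    rw [hO, inner_smul_left, inner_smul_right, inner_self_eq_norm_sq_to_K, inner_conj_symm]
    push_cast
    exact (mul_assoc _ _ _).symm
  · convert hasTrace_rankOne hψ (((inner ℂ ψ (O ⟨ψ, h⟩)).re : ℝ) : ℂ) using 2 with φ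
    rw [hO, hs, inner_smul_left, inner_smul_right, inner_conj_symm,
      show (((inner ℂ ψ (O ⟨ψ, h⟩)).re : ℝ) : ℂ) = inner ℂ ψ (O ⟨ψ, h⟩) from
        Complex.ext (by simp) (by simp [hre])]
    exact (mul_assoc _ _ _).symm

/-- Pure states are mixed states. -/
theorem pureRegion_subset_mixedRegion {A B : E →ₗ.[ℂ] E}
    (hA : ∀ (ψ : E) (h : ψ ∈ A.domain), (inner ℂ ψ (A ⟨ψ, h⟩)).im = 0)
    (hB : ∀ (ψ : E) (h : ψ ∈ B.domain), (inner ℂ ψ (B ⟨ψ, h⟩)).im = 0) :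
    pureRegion A B ⊆ mixedRegion A B := by
  rintro v ⟨ψ, hψ, h₁, h₂, rfl⟩
  exact ⟨_, isDensityOperator_rankOne hψ, hasStdDev_rankOne hψ h₁ (hA ψ h₁),
    hasStdDev_rankOne hψ h₂ (hB ψ h₂)⟩

/-- As √ρ is self-adjoint, ⟨e, ρe⟩ = ‖√ρ e‖². The vectors √ρ eᵢ thus act as an unnormalised ensemble
of total weight 1. -/
theorem IsDensityOperator.hasSum_norm_sqrt_sq {ρ : E →L[ℂ] E} (h : IsDensityOperator ρ)
    {ι : Type u} (b : HilbertBasis ι ℂ E) : HasSum (fun i => ‖CFC.sqrt ρ (b i)‖ ^ 2) 1 := by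
  have h₀ : 0 ≤ ρ := (ContinuousLinearMap.nonneg_iff_isPositive _).2 h.1
  have hs : (CFC.sqrt ρ).IsPositive :=
    (ContinuousLinearMap.nonneg_iff_isPositive _).1 (CFC.sqrt_nonneg ρ)
  have h₁ := h.2.re_hasSum b
  rw [Complex.one_re] at h₁
  refine h₁.congr_fun fun i => ?_
  conv_rhs => rw [← CFC.sqrt_mul_sqrt_self ρ h₀]
  rw [mul_apply_eq_comp, ← hs.isSymmetric.apply_clm]
  exact (inner_self_eq_norm_sq (𝕜 := ℂ) _).symm

end

/-- The variance `q - m²` as a sum over a basis. -/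
theorem hasSum_centered {E : Type*} [NormedAddCommGroup E] [InnerProductSpace ℂ E] {ι : Type*}
    {ψ φ : ι → E} {q m : ℝ} (h₁ : HasSum (fun i => ‖ψ i‖ ^ 2) 1)
    (h₂ : HasSum (fun i => (inner ℂ (φ i) (φ i)).re) q)
    (h₃ : HasSum (fun i => (inner ℂ (ψ i) (φ i)).re) m) :
    HasSum (fun i => ‖φ i - (m : ℂ) • ψ i‖ ^ 2) (q - m ^ 2) := by
  have h := (h₂.sub (h₃.mul_left (2 * m))).add (h₁.mul_left (m ^ 2))
  have e : q - 2 * m * m + m ^ 2 * 1 = q - m ^ 2 := by ring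
  rw [e] at h
  refine h.congr_fun fun i => ?_
  rw [norm_sub_real_smul_sq]
  congr 2
  exact (inner_self_eq_norm_sq (𝕜 := ℂ) _).symm

theorem mixedRegion_subset_hyperbolicRegion {ħ : ℝ} (hħ : 0 < ħ) :
    mixedRegion position (momentum ħ) ⊆ hyperbolicRegion ħ := by
  rintro ⟨x, y⟩ ⟨ρ, hρ, ⟨hA, q, m, hq, hm, hx⟩, ⟨hB, r, n, hr, hn, hy⟩⟩
  obtain ⟨w, b, -⟩ := exists_hilbertBasis ℂ L2
  have h₁ := hρ.hasSum_norm_sqrt_sq b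
  have hV := hasSum_centered h₁ (hq.re_hasSum b) (hm.re_hasSum b)
  have hW := hasSum_centered h₁ (hr.re_hasSum b) (hn.re_hasSum b)
  simp only [Complex.ofReal_re] at hV hW hx hy
  set V := q - m ^ 2
  set W := r - n ^ 2
  have hV₀ : 0 ≤ V := hV.nonneg fun i => sq_nonneg _
  have hW₀ : 0 ≤ W := hW.nonneg fun i => sq_nonneg _
  have key : ∀ l : ℝ, 0 ≤ V * (l * l) + -ħ * l + W := by
    intro l
    have := hasSum_le (fun i => uncertainty_quadratic (hA (b i)) (hB (b i)) m n l)
      (h₁.mul_left (l * ħ)) ((hV.mul_left (l ^ 2)).add hW)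
    linarith
  have hd := discrim_le_zero key
  rw [discrim] at hd
  have hxy : ħ / 2 ≤ x * y := by
    rw [hx, hy, ← Real.sqrt_mul hV₀]
    exact Real.le_sqrt_of_sq_le (by linarith)
  have hx₀ : 0 ≤ x := hx ▸ Real.sqrt_nonneg _
  have hy₀ : 0 ≤ y := hy ▸ Real.sqrt_nonneg _
  -- Strict positivity comes for free: neither factor can vanish.
  have hpos : 0 < x * y := by linarith
  exact ⟨hxy, hx₀.lt_of_ne fun h => by simp [← h] at hpos,
    hy₀.lt_of_ne fun h => by simp [← h] at hpos⟩

/-! ### Gaussian wave functions -/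

/-- A quadratic polynomial times the exponential of a quadratic polynomial. -/
noncomputable def polyGauss (c₀ c₁ c₂ α β γ : ℂ) (x : ℝ) : ℂ :=
  (c₀ + c₁ * x + c₂ * x ^ 2) * Complex.exp (α + β * x + γ * x ^ 2)

theorem norm_exp_quadratic (α β γ : ℂ) (x : ℝ) :
    ‖Complex.exp (α + β * x + γ * x ^ 2)‖ = Real.exp (α.re + β.re * x + γ.re * x ^ 2) := by
  rw [Complex.norm_exp]
  congr 1
  simp [← Complex.ofReal_pow]

/-- A common majorant of the functions `polyGauss` with bounded coefficients. -/
noncomputable def gaussMajorant (M δ x : ℝ) : ℝ :=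
  3 * M * (2 * Real.exp (M + (M + 1) ^ 2 / (2 * δ))) * Real.exp (-(δ / 2) * x ^ 2)

theorem memLp_gaussMajorant (M : ℝ) {δ : ℝ} (hδ : 0 < δ) : MemLp (gaussMajorant M δ) 2 := by
  refine MemLp.const_mul ?_ _
  refine (memLp_two_iff_integrable_sq (by fun_prop)).2 ?_
  refine (integrable_exp_neg_mul_sq hδ).congr (.of_forall fun x => ?_)
  simp only [← Real.exp_nat_mul]
  congr 1
  push_cast
  ring

/-- The polynomial costs a factor e^|x|, and half of δx² absorbs all terms linear in |x| by
completing the square. Uniformity in the coefficients makes the bound serve for domination in time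
as well as for membership in L². -/
theorem norm_polyGauss_le {c₀ c₁ c₂ α β γ : ℂ} {M δ : ℝ} (hδ : 0 < δ) (h₀ : ‖c₀‖ ≤ M)
    (h₁ : ‖c₁‖ ≤ M) (h₂ : ‖c₂‖ ≤ M) (hα : ‖α‖ ≤ M) (hβ : ‖β‖ ≤ M) (hγ : γ.re ≤ -δ) (x : ℝ) :
    ‖polyGauss c₀ c₁ c₂ α β γ x‖ ≤ gaussMajorant M δ x := by
  have hM : 0 ≤ M := (norm_nonneg _).trans h₀
  have hx : ‖(x : ℂ)‖ = |x| := by simp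
  have e₁ : ‖c₀ + c₁ * x + c₂ * x ^ 2‖ ≤ 3 * M * (2 * Real.exp |x|) := by
    have a₁ : |x| ≤ Real.exp |x| := by linarith [Real.add_one_le_exp |x|]
    have a₂ : (1 : ℝ) ≤ Real.exp |x| := Real.one_le_exp (abs_nonneg x)
    have a₃ : |x| ^ 2 ≤ 2 * Real.exp |x| := by
      linarith [Real.quadratic_le_exp_of_nonneg (abs_nonneg x), abs_nonneg x]
    calc ‖c₀ + c₁ * x + c₂ * x ^ 2‖ ≤ ‖c₀‖ + ‖c₁‖ * |x| + ‖c₂‖ * |x| ^ 2 := by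
          refine (norm_add₃_le).trans ?_
          rw [norm_mul, norm_mul, norm_pow, hx]
      _ ≤ M * (2 * Real.exp |x|) + M * (2 * Real.exp |x|) + M * (2 * Real.exp |x|) := by
          gcongr
          · exact h₀.trans (le_mul_of_one_le_right hM (by linarith))
          · linarith
      _ = _ := by ring
  have e₂ : ‖Complex.exp (α + β * x + γ * x ^ 2)‖ ≤ Real.exp (M + M * |x| - δ * x ^ 2) := by
    rw [norm_exp_quadratic, Real.exp_le_exp]
    have b₁ := (Complex.re_le_norm α).trans hα
    have b₂ : β.re * x ≤ M * |x| := by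
      refine (le_abs_self _).trans ?_
      rw [abs_mul]
      gcongr
      exact (Complex.abs_re_le_norm β).trans hβ
    have b₃ := mul_le_mul_of_nonneg_right hγ (sq_nonneg x)
    linarith
  have e₃ : |x| + (M + M * |x| - δ * x ^ 2) ≤ M + (M + 1) ^ 2 / (2 * δ) + -(δ / 2) * x ^ 2 := by
    have h : 0 ≤ (δ * |x| - (M + 1)) ^ 2 / (2 * δ) := by positivity
    have h' : (δ * |x| - (M + 1)) ^ 2 / (2 * δ) =
        δ / 2 * |x| ^ 2 - (M + 1) * |x| + (M + 1) ^ 2 / (2 * δ) := by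
      field_simp
      ring
    rw [h', sq_abs] at h
    linarith
  rw [polyGauss, norm_mul, gaussMajorant]
  calc _ ≤ 3 * M * (2 * Real.exp |x|) * Real.exp (M + M * |x| - δ * x ^ 2) := by gcongr
    _ = 3 * M * (2 * Real.exp (|x| + (M + M * |x| - δ * x ^ 2))) := by rw [Real.exp_add]; ring
    _ ≤ 3 * M * (2 * Real.exp (M + (M + 1) ^ 2 / (2 * δ) + -(δ / 2) * x ^ 2)) := by gcongr
    _ = _ := by rw [Real.exp_add]; ring

theorem memLp_polyGauss (c₀ c₁ c₂ α β : ℂ) {γ : ℂ} (hγ : γ.re < 0) :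
    MemLp (polyGauss c₀ c₁ c₂ α β γ) 2 := by
  refine (memLp_gaussMajorant (‖c₀‖ + ‖c₁‖ + ‖c₂‖ + ‖α‖ + ‖β‖) (neg_pos.2 hγ)).mono'
    (Continuous.aestronglyMeasurable (by unfold polyGauss; fun_prop)) (.of_forall fun x => ?_)
  have := norm_nonneg c₀
  have := norm_nonneg c₁
  have := norm_nonneg c₂
  have := norm_nonneg α
  have := norm_nonneg β
  apply norm_polyGauss_le (neg_pos.2 hγ) <;> linarith

/-- The function `polyGauss` as an element of `L²`. -/
noncomputable def gaussState (c₀ c₁ c₂ α β : ℂ) {γ : ℂ} (hγ : γ.re < 0) : L2 :=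
  (memLp_polyGauss c₀ c₁ c₂ α β hγ).toLp

theorem gaussState_coeFn (c₀ c₁ c₂ α β : ℂ) {γ : ℂ} (hγ : γ.re < 0) :
    gaussState c₀ c₁ c₂ α β hγ =ᵐ[volume] polyGauss c₀ c₁ c₂ α β γ :=
  MemLp.coeFn_toLp _

/-! ### Gaussians: derivatives in space and in time -/

theorem hasL2Deriv_toLp {f f' : ℝ → ℂ} (hf : MemLp f 2) (hf' : MemLp f' 2)
    (h : ∀ x, HasDerivAt f (f' x) x) : HasL2Deriv hf.toLp hf'.toLp := by
  refine ⟨f 0, ?_⟩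
  filter_upwards [hf.coeFn_toLp] with x hx
  have e : ∫ t in (0 : ℝ)..x, (hf'.toLp : L2) t = ∫ t in (0 : ℝ)..x, f' t :=
    intervalIntegral.integral_congr_ae (by
      filter_upwards [hf'.coeFn_toLp] with t ht _ using ht)
  have hi : IntervalIntegrable f' volume 0 x :=
    (L2.intervalIntegrable hf'.toLp 0 x).congr_ae (ae_restrict_of_ae hf'.coeFn_toLp)
  rw [hx, e, intervalIntegral.integral_eq_sub_of_hasDerivAt (fun t _ => h t) hi]
  ring

/-- Each derivative raises the degree of the polynomial factor by one; degree at most 2 is enough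
room to apply p twice to a pure Gaussian. -/
theorem hasL2Deriv_gaussState (c₀ c₁ α β : ℂ) {γ : ℂ} (hγ : γ.re < 0) :
    HasL2Deriv (gaussState c₀ c₁ 0 α β hγ)
      (gaussState (c₁ + c₀ * β) (c₁ * β + 2 * γ * c₀) (2 * γ * c₁) α β hγ) := by
  refine hasL2Deriv_toLp _ _ fun x => ?_
  have hx : HasDerivAt (fun x : ℝ => (x : ℂ)) 1 x := Complex.ofRealCLM.hasDerivAt
  have h₁ := ((hx.const_mul c₁).const_add c₀).add ((hx.pow 2).const_mul 0)
  have h₂ := (((hx.const_mul β).const_add α).add ((hx.pow 2).const_mul γ)).cexp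
  convert! h₁.mul h₂ using 1
  simp [polyGauss]
  ring

/-- The mean value inequality bounds the difference quotients by G, so their squared error is at
most (2G)² and dominated convergence applies. -/
theorem hasDerivAt_toLp {F F' : ℝ → ℝ → ℂ} {G : ℝ → ℝ} {t₀ : ℝ} (hF : ∀ t, MemLp (F t) 2)
    (hF' : MemLp (F' t₀) 2) (hG : MemLp G 2)
    (hd : ∀ x, ∀ t ∈ Metric.ball t₀ 1, HasDerivAt (fun t => F t x) (F' t x) t)
    (hb : ∀ x, ∀ t ∈ Metric.ball t₀ 1, ‖F' t x‖ ≤ G x) :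
    HasDerivAt (fun t => (hF t).toLp : ℝ → L2) hF'.toLp t₀ := by
  have ht₀ : t₀ ∈ Metric.ball t₀ 1 := Metric.mem_ball_self one_pos
  rw [hasDerivAt_iff_tendsto_slope, tendsto_iff_norm_sub_tendsto_zero]
  have key : Tendsto (fun t => ∫ x, ‖slope (fun t => F t x) t₀ t - F' t₀ x‖ ^ 2) (𝓝[≠] t₀)
      (𝓝 (∫ _ : ℝ, (0 : ℝ))) := by
    refine tendsto_integral_filter_of_dominated_convergence (fun x => (2 * G x) ^ 2) ?_ ?_ ?_ ?_
    · refine .of_forall fun t => ?_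
      simp only [slope_def_module]
      exact ((((hF t).1.sub (hF t₀).1).const_smul _).sub hF'.1).norm.pow 2
    · have hball : Metric.ball t₀ 1 ∈ 𝓝[≠] t₀ :=
        mem_nhdsWithin_of_mem_nhds (Metric.ball_mem_nhds _ one_pos)
      filter_upwards [hball, self_mem_nhdsWithin] with t ht hne
      refine .of_forall fun x => ?_
      have h := (convex_ball t₀ 1).norm_image_sub_le_of_norm_hasDerivWithin_le
        (fun s hs => (hd x s hs).hasDerivWithinAt) (hb x) ht₀ ht
      have hpos : 0 < ‖t - t₀‖ := norm_pos_iff.2 (sub_ne_zero.2 hne)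
      have h' : ‖slope (fun t => F t x) t₀ t‖ ≤ G x := by
        rw [slope_def_module, norm_smul, norm_inv, inv_mul_le_iff₀ hpos, mul_comm]
        exact h
      rw [Real.norm_eq_abs, abs_of_nonneg (sq_nonneg _)]
      gcongr
      linarith [norm_sub_le (slope (fun t => F t x) t₀ t) (F' t₀ x), hb x t₀ ht₀]
    · exact (hG.const_mul 2).integrable_sq
    · refine .of_forall fun x => ?_
      have h := (hasDerivAt_iff_tendsto_slope.1 (hd x t₀ ht₀)).sub_const (F' t₀ x)
      simpa using h.norm.pow 2
  rw [integral_zero] at key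
  have := key.sqrt
  rw [Real.sqrt_zero] at this
  refine this.congr fun t => ?_
  rw [Real.sqrt_eq_iff_mul_self_eq (by positivity) (norm_nonneg _), ← sq, L2.norm_sq_eq_integral]
  refine integral_congr_ae ?_
  rw [slope_def_module]
  filter_upwards [Lp.coeFn_sub ((t - t₀)⁻¹ • ((hF t).toLp - (hF t₀).toLp)) hF'.toLp,
    Lp.coeFn_smul (t - t₀)⁻¹ ((hF t).toLp - (hF t₀).toLp), Lp.coeFn_sub (hF t).toLp (hF t₀).toLp,
    hF'.coeFn_toLp, (hF t).coeFn_toLp, (hF t₀).coeFn_toLp] with x h₁ h₂ h₃ h₄ h₅ h₆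
  simp only [h₁, h₂, h₃, h₄, h₅, h₆, Pi.sub_apply, Pi.smul_apply, slope_def_module]

theorem hasDerivAt_gaussState {α β γ α' β' γ' : ℝ → ℂ} (hγ : ∀ t, (γ t).re < 0)
    (dα : ∀ t, HasDerivAt α (α' t) t) (dβ : ∀ t, HasDerivAt β (β' t) t)
    (dγ : ∀ t, HasDerivAt γ (γ' t) t) (cα : Continuous α') (cβ : Continuous β')
    (cγ : Continuous γ') (t : ℝ) :
    HasDerivAt (fun t => gaussState 1 0 0 (α t) (β t) (hγ t))
      (gaussState (α' t) (β' t) (γ' t) (α t) (β t) (hγ t)) t := by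
  have bound : ∀ f : ℝ → ℂ, Continuous f → ∃ C, ∀ s ∈ Metric.closedBall t 1, ‖f s‖ ≤ C :=
    fun f hf => (isCompact_closedBall t 1).exists_bound_of_continuousOn hf.continuousOn
  have dcont : ∀ f f' : ℝ → ℂ, (∀ t, HasDerivAt f (f' t) t) → Continuous f := fun f f' h =>
    continuous_iff_continuousAt.2 fun t => (h t).continuousAt
  obtain ⟨C₁, h₁⟩ := bound α' cα
  obtain ⟨C₂, h₂⟩ := bound β' cβ
  obtain ⟨C₃, h₃⟩ := bound γ' cγ
  obtain ⟨C₄, h₄⟩ := bound α (dcont _ _ dα)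
  obtain ⟨C₅, h₅⟩ := bound β (dcont _ _ dβ)
  -- By compactness the largest Re γ near t is attained, hence still negative: a uniform decay rate.
  obtain ⟨s₀, -, hs₀⟩ := (isCompact_closedBall t 1).exists_isMaxOn
    ⟨t, Metric.mem_closedBall_self zero_le_one⟩
    (Complex.continuous_re.comp (dcont _ _ dγ)).continuousOn
  have ht : t ∈ Metric.closedBall t 1 := Metric.mem_closedBall_self zero_le_one
  have p₁ := (norm_nonneg _).trans (h₁ t ht)
  have p₂ := (norm_nonneg _).trans (h₂ t ht)
  have p₃ := (norm_nonneg _).trans (h₃ t ht)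
  have p₄ := (norm_nonneg _).trans (h₄ t ht)
  have p₅ := (norm_nonneg _).trans (h₅ t ht)
  refine hasDerivAt_toLp (F := fun t => polyGauss 1 0 0 (α t) (β t) (γ t))
    (F' := fun t => polyGauss (α' t) (β' t) (γ' t) (α t) (β t) (γ t)) _ _
    (memLp_gaussMajorant (C₁ + C₂ + C₃ + C₄ + C₅) (neg_pos.2 (hγ s₀))) (fun x s _ => ?_)
    fun x s hs => ?_
  · have h := (((dα s).add ((dβ s).mul_const (x : ℂ))).add
      ((dγ s).mul_const ((x : ℂ) ^ 2))).cexp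
    convert! h using 1
    · ext s
      simp [polyGauss]
    · simp [polyGauss]
      ring
  · have hs' := Metric.ball_subset_closedBall hs
    have q₁ := h₁ s hs'
    have q₂ := h₂ s hs'
    have q₃ := h₃ s hs'
    have q₄ := h₄ s hs'
    have q₅ := h₅ s hs'
    have q₆ : (γ s).re ≤ (γ s₀).re := hs₀ hs'
    apply norm_polyGauss_le (neg_pos.2 (hγ s₀)) <;> linarith

theorem gaussState_mem_momentum_domain (ħ : ℝ) (c₀ c₁ α β : ℂ) {γ : ℂ} (hγ : γ.re < 0) :
    gaussState c₀ c₁ 0 α β hγ ∈ (momentum ħ).domain :=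
  ⟨_, hasL2Deriv_gaussState c₀ c₁ α β hγ⟩

theorem smul_gaussState (c c₀ c₁ c₂ α β : ℂ) {γ : ℂ} (hγ : γ.re < 0) :
    c • gaussState c₀ c₁ c₂ α β hγ = gaussState (c * c₀) (c * c₁) (c * c₂) α β hγ := by
  rw [gaussState, gaussState, ← MemLp.toLp_const_smul, MemLp.toLp_eq_toLp_iff]
  refine .of_forall fun x => ?_
  simp only [Pi.smul_apply, polyGauss, smul_eq_mul]
  ring

theorem momentum_gaussState (ħ : ℝ) (c₀ c₁ α β : ℂ) {γ : ℂ} (hγ : γ.re < 0)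
    (h : gaussState c₀ c₁ 0 α β hγ ∈ (momentum ħ).domain) :
    momentum ħ ⟨gaussState c₀ c₁ 0 α β hγ, h⟩ = (-(Complex.I * ħ)) •
      gaussState (c₁ + c₀ * β) (c₁ * β + 2 * γ * c₀) (2 * γ * c₁) α β hγ :=
  momentum_apply (hasL2Deriv_gaussState c₀ c₁ α β hγ) h

/-- A Gaussian whose exponent solves the Riccati system is a free evolution. -/
theorem isFreeEvolution_gaussState {ħ m : ℝ} (hħ : ħ ≠ 0) {α β γ : ℝ → ℂ}
    (hγ : ∀ t, (γ t).re < 0)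
    (dα : ∀ t, HasDerivAt α (Complex.I * ħ / (2 * m) * (β t ^ 2 + 2 * γ t)) t)
    (dβ : ∀ t, HasDerivAt β (Complex.I * ħ / (2 * m) * (4 * β t * γ t)) t)
    (dγ : ∀ t, HasDerivAt γ (Complex.I * ħ / (2 * m) * (4 * γ t ^ 2)) t) :
    IsFreeEvolution ħ m fun t => gaussState 1 0 0 (α t) (β t) (hγ t) := by
  intro t
  have cβ : Continuous β := continuous_iff_continuousAt.2 fun t => (dβ t).continuousAt
  have cγ : Continuous γ := continuous_iff_continuousAt.2 fun t => (dγ t).continuousAt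
  have h₁ := gaussState_mem_momentum_domain ħ 1 0 (α t) (β t) (hγ t)
  have e₁ : momentum ħ ⟨_, h₁⟩ =
      gaussState (-(Complex.I * ħ) * β t) (-(Complex.I * ħ) * (2 * γ t)) 0 (α t) (β t) (hγ t) := by
    rw [momentum_gaussState, smul_gaussState]
    congr 1 <;> ring
  have h₂ : momentum ħ ⟨_, h₁⟩ ∈ (momentum ħ).domain :=
    e₁ ▸ gaussState_mem_momentum_domain ħ _ _ (α t) (β t) (hγ t)
  refine ⟨h₁, h₂, ?_⟩
  have hd := hasDerivAt_gaussState hγ dα dβ dγ (by fun_prop) (by fun_prop) (by fun_prop) t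
  convert hd using 1
  simp only [e₁]
  rw [momentum_gaussState, smul_gaussState, smul_gaussState, smul_gaussState]
  have hI : (ħ : ℂ) ≠ 0 := Complex.ofReal_ne_zero.2 hħ
  have hI' := Complex.I_ne_zero
  -- With this constant, the coefficients of 1, x and x² match the three equations of the system.
  have h3 : (Complex.I * ħ)⁻¹ * ((2 * (m : ℂ))⁻¹ * (-(Complex.I * ħ) * -(Complex.I * ħ))) =
      Complex.I * ħ / (2 * m) := by
    field_simp
  congr 1 <;> rw [← h3] <;> ring

/-! ### Standard deviations of Gaussian states -/

open ProbabilityTheory in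
theorem integral_id_mul_gaussianPDFReal (μ : ℝ) {v : NNReal} (hv : v ≠ 0) :
    ∫ x, x * gaussianPDFReal μ v x = μ := by
  have h := integral_gaussianReal_eq_integral_smul (μ := μ) hv (f := fun x => x)
  rw [integral_id_gaussianReal] at h
  refine (h.trans ?_).symm
  simp only [smul_eq_mul, mul_comm]

open ProbabilityTheory in
theorem integral_sq_mul_gaussianPDFReal (μ : ℝ) {v : NNReal} (hv : v ≠ 0) :
    ∫ x, x ^ 2 * gaussianPDFReal μ v x = v + μ ^ 2 := by
  have h := integral_gaussianReal_eq_integral_smul (μ := μ) hv (f := fun x => x ^ 2)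
  have h' := variance_eq_sub (memLp_id_gaussianReal (μ := μ) (v := v) 2)
  rw [variance_id_gaussianReal] at h'
  simp only [Pi.pow_apply, id, integral_id_gaussianReal] at h'
  rw [h', h, sub_add_cancel]
  simp only [smul_eq_mul, mul_comm]

section GaussianDensity

open ProbabilityTheory

variable {ψ : L2} {μ : ℝ} {v : NNReal} (hv : v ≠ 0)
  (h : ∀ᵐ x, ‖ψ x‖ ^ 2 = gaussianPDFReal μ v x)

include hv h

theorem norm_eq_one_of_gaussian : ‖ψ‖ = 1 := by
  have e : ‖ψ‖ ^ 2 = 1 := by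
    rw [L2.norm_sq_eq_integral, integral_congr_ae h, integral_gaussianPDFReal_eq_one μ hv]
  exact (pow_eq_one_iff_of_nonneg (norm_nonneg ψ) two_ne_zero).1 e

theorem re_inner_position_of_gaussian (hx : ψ ∈ position.domain) :
    (inner ℂ ψ (position ⟨ψ, hx⟩)).re = μ := by
  rw [L2.re_inner, ← integral_id_mul_gaussianPDFReal μ hv]
  refine integral_congr_ae ?_
  filter_upwards [h, position_coeFn hx] with x h₁ h₂
  rw [h₂, ← h₁, ← Complex.real_smul, real_inner_smul_right, real_inner_self_eq_norm_sq]

theorem norm_position_sq_of_gaussian (hx : ψ ∈ position.domain) :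
    ‖position ⟨ψ, hx⟩‖ ^ 2 = v + μ ^ 2 := by
  rw [L2.norm_sq_eq_integral, ← integral_sq_mul_gaussianPDFReal μ hv]
  refine integral_congr_ae ?_
  filter_upwards [h, position_coeFn hx] with x h₁ h₂
  rw [h₂, norm_mul, mul_pow, h₁]
  simp

theorem stdDev_position_of_gaussian (hx : ψ ∈ position.domain) :
    stdDev position ⟨ψ, hx⟩ = √v := by
  rw [stdDev, norm_position_sq_of_gaussian hv h, re_inner_position_of_gaussian hv h]
  congr 1
  ring

end GaussianDensity

/-- Variances scale quadratically under affine maps of the observable. -/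
theorem variance_affine {E : Type*} [NormedAddCommGroup E] [InnerProductSpace ℂ E] {ψ X P : E}
    {c d : ℂ} (hψ : ‖ψ‖ = 1) (hP : P = c • ψ + d • X) (hX₀ : (inner ℂ ψ X).im = 0)
    (hP₀ : (inner ℂ ψ P).im = 0) :
    ‖P‖ ^ 2 - (inner ℂ ψ P).re ^ 2 = ‖d‖ ^ 2 * (‖X‖ ^ 2 - (inner ℂ ψ X).re ^ 2) := by
  have e₁ : inner ℂ ψ P = c + d * (inner ℂ ψ X).re := by
    rw [hP, inner_add_right, inner_smul_right, inner_smul_right, inner_self_eq_norm_sq_to_K, hψ,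
      show (((inner ℂ ψ X).re : ℝ) : ℂ) = inner ℂ ψ X from Complex.ext (by simp) (by simp [hX₀])]
    simp
  have e₂ := norm_add_sq (𝕜 := ℂ) (c • ψ) (d • X)
  rw [← hP, norm_smul, norm_smul, hψ, inner_smul_left, inner_smul_right,
    show inner ℂ ψ X = (((inner ℂ ψ X).re : ℝ) : ℂ) from
      Complex.ext (by simp) (by simp [hX₀])] at e₂
  rw [e₁] at hP₀ ⊢
  rw [e₂]
  set r := (inner ℂ ψ X).re
  simp only [mul_pow, ← Complex.normSq_eq_norm_sq, Complex.normSq_apply]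
  simp at hP₀ ⊢
  -- `hP₀` says Im(c + dr) = 0, so |c + dr|² equals (Re(c + dr))².
  linear_combination (c.im + d.im * r) * hP₀

theorem gaussState_mem_position_domain (α β : ℂ) {γ : ℂ} (hγ : γ.re < 0) :
    gaussState 1 0 0 α β hγ ∈ position.domain := by
  change MemLp (fun x : ℝ => (x : ℂ) * gaussState 1 0 0 α β hγ x) 2 volume
  refine (memLp_polyGauss 0 1 0 α β hγ).ae_eq ?_
  filter_upwards [gaussState_coeFn 1 0 0 α β hγ] with x hx
  rw [hx]
  simp [polyGauss]

/-- Since ψ' = (β + 2γx)ψ, p acts on a Gaussian as an affine function of x. So Δp follows from Δx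
without a Fourier transform. -/
theorem momentum_gaussState_eq (ħ : ℝ) (α β : ℂ) {γ : ℂ} (hγ : γ.re < 0)
    (hx : gaussState 1 0 0 α β hγ ∈ position.domain)
    (hp : gaussState 1 0 0 α β hγ ∈ (momentum ħ).domain) :
    momentum ħ ⟨_, hp⟩ = (-(Complex.I * ħ) * β) • gaussState 1 0 0 α β hγ +
      (-(Complex.I * ħ) * (2 * γ)) • position ⟨_, hx⟩ := by
  have e : position ⟨_, hx⟩ = gaussState 0 1 0 α β hγ := by
    apply Lp.ext
    filter_upwards [position_coeFn hx, gaussState_coeFn 1 0 0 α β hγ,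
      gaussState_coeFn 0 1 0 α β hγ] with x h₁ h₂ h₃
    rw [h₁, h₂, h₃]
    simp [polyGauss]
  rw [momentum_gaussState, e, smul_gaussState, smul_gaussState, smul_gaussState, gaussState,
    gaussState, gaussState, ← MemLp.toLp_add, MemLp.toLp_eq_toLp_iff]
  refine .of_forall fun x => ?_
  simp only [Pi.add_apply, polyGauss]
  ring

open ProbabilityTheory in
theorem stdDev_momentum_gaussState {ħ : ℝ} (hħ : 0 < ħ) {α β γ : ℂ} (hγ : γ.re < 0) {μ : ℝ}
    {v : NNReal} (hv : v ≠ 0)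
    (h : ∀ᵐ x, ‖gaussState 1 0 0 α β hγ x‖ ^ 2 = gaussianPDFReal μ v x)
    (hp : gaussState 1 0 0 α β hγ ∈ (momentum ħ).domain) :
    stdDev (momentum ħ) ⟨_, hp⟩ = 2 * ħ * ‖γ‖ * √v := by
  have hx := gaussState_mem_position_domain α β hγ
  have e := variance_affine (norm_eq_one_of_gaussian hv h) (momentum_gaussState_eq ħ α β hγ hx hp)
    (im_inner_position hx) (im_inner_momentum hp)
  rw [norm_position_sq_of_gaussian hv h, re_inner_position_of_gaussian hv h] at e
  rw [stdDev]
  refine (congrArg Real.sqrt e).trans ?_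
  have e' : ‖-(Complex.I * ħ) * (2 * γ)‖ = 2 * ħ * ‖γ‖ := by
    simp [abs_of_pos hħ]
    ring
  rw [e', add_sub_cancel_right, Real.sqrt_mul (sq_nonneg _), Real.sqrt_sq (by positivity)]

/-! ### The freely evolving wave packet -/

/-- The complex squared width of a packet at time `t`, with `s = ħ / m`. -/
noncomputable def width (a s t : ℝ) : ℂ := (a ^ 2 : ℝ) + Complex.I * ((s * t : ℝ) : ℂ)

/-- Constant coefficient of the exponent of the evolved packet. -/
noncomputable def exponentConst (a k₀ s t : ℝ) : ℂ :=
  ((Real.log (a / √Real.pi) / 2 - k₀ ^ 2 / 2 : ℝ) : ℂ) - Complex.log (width a s t) / 2 +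
    (a * k₀ : ℂ) ^ 2 / 2 * (width a s t)⁻¹

/-- Linear coefficient of the exponent of the evolved packet. -/
noncomputable def exponentLin (a k₀ s t : ℝ) : ℂ := Complex.I * (a * k₀) * (width a s t)⁻¹

/-- Quadratic coefficient of the exponent of the evolved packet. -/
noncomputable def exponentQuad (a s t : ℝ) : ℂ := -(1 / 2) * (width a s t)⁻¹

section Packet

variable {a : ℝ} (ha : 0 < a) (k₀ s t : ℝ)

theorem width_re : (width a s t).re = a ^ 2 := by simp [width, -Complex.ofReal_pow]

theorem width_im : (width a s t).im = s * t := by simp [width, -Complex.ofReal_pow]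

theorem normSq_width : Complex.normSq (width a s t) = a ^ 4 + (s * t) ^ 2 := by
  rw [Complex.normSq_apply, width_re, width_im]
  ring

theorem hasDerivAt_width : HasDerivAt (width a s) (Complex.I * s) t := by
  have h : HasDerivAt (fun t : ℝ => ((s * t : ℝ) : ℂ)) (s : ℂ) t := by
    simpa using ((hasDerivAt_id t).const_mul s).ofReal_comp
  exact (h.const_mul Complex.I).const_add _

include ha

theorem width_ne_zero : width a s t ≠ 0 := fun h => by
  have := width_re (a := a) s t
  rw [h, Complex.zero_re] at this
  exact (pow_pos ha 2).ne this

/-- The width is affine in t, so its inverse solves a Riccati equation; `exponentQuad` and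
`exponentLin` are constant multiples of it. -/
theorem hasDerivAt_width_inv :
    HasDerivAt (fun t => (width a s t)⁻¹) (-(Complex.I * s) * (width a s t)⁻¹ ^ 2) t := by
  convert! (hasDerivAt_width s t).inv (width_ne_zero ha s t) using 1
  rw [inv_pow, div_eq_mul_inv]

theorem exponentQuad_re_neg : (exponentQuad a s t).re < 0 := by
  have h : (exponentQuad a s t).re = -(1 / 2) * (a ^ 2 / (a ^ 4 + (s * t) ^ 2)) := by
    rw [← normSq_width, ← width_re s t, exponentQuad, ← Complex.inv_re]
    simp
  rw [h]
  have : 0 < a ^ 2 / (a ^ 4 + (s * t) ^ 2) := by positivity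
  linarith

theorem hasDerivAt_exponentQuad : HasDerivAt (exponentQuad a s)
    (Complex.I * s / 2 * (4 * exponentQuad a s t ^ 2)) t := by
  convert! (hasDerivAt_width_inv ha s t).const_mul (-(1 / 2) : ℂ) using 1
  rw [exponentQuad]
  ring

theorem hasDerivAt_exponentLin : HasDerivAt (exponentLin a k₀ s)
    (Complex.I * s / 2 * (4 * exponentLin a k₀ s t * exponentQuad a s t)) t := by
  convert! (hasDerivAt_width_inv ha s t).const_mul (Complex.I * (a * k₀) : ℂ) using 1
  rw [exponentQuad, exponentLin]
  ring

theorem hasDerivAt_exponentConst : HasDerivAt (exponentConst a k₀ s)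
    (Complex.I * s / 2 * (exponentLin a k₀ s t ^ 2 + 2 * exponentQuad a s t)) t := by
  -- Re w = a² > 0 keeps the principal logarithm differentiable for all times.
  have hm : width a s t ∈ Complex.slitPlane := Or.inl (by rw [width_re]; positivity)
  have hl : HasDerivAt (fun t => Complex.log (width a s t)) (Complex.I * s / width a s t) t :=
    (hasDerivAt_width s t).clog_real hm
  convert! (hl.div_const 2 |>.const_sub _).add
    ((hasDerivAt_width_inv ha s t).const_mul ((a * k₀ : ℂ) ^ 2 / 2)) using 1
  rw [exponentQuad, exponentLin, mul_pow, mul_pow, Complex.I_sq]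
  ring

/-- The freely evolving Gaussian wave packet. -/
noncomputable def packet : L2 :=
  gaussState 1 0 0 (exponentConst a k₀ s t) (exponentLin a k₀ s t) (exponentQuad_re_neg ha s t)

theorem isFreeEvolution_packet {ħ m : ℝ} (hħ : 0 < ħ) (hm : 0 < m) :
    IsFreeEvolution ħ m (packet ha k₀ (ħ / m)) := by
  have e : Complex.I * ħ / (2 * m) = Complex.I * ((ħ / m : ℝ) : ℂ) / 2 := by
    have : (m : ℂ) ≠ 0 := Complex.ofReal_ne_zero.2 hm.ne'
    push_cast
    field_simp
  refine isFreeEvolution_gaussState hħ.ne' (exponentQuad_re_neg ha (ħ / m)) (fun t => ?_)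
    (fun t => ?_) fun t => ?_ <;> rw [e]
  · exact hasDerivAt_exponentConst ha k₀ _ t
  · exact hasDerivAt_exponentLin ha k₀ _ t
  · exact hasDerivAt_exponentQuad ha _ t

theorem packet_zero : packet ha k₀ s 0 =ᵐ[volume] gaussianPacket a k₀ := by
  refine (gaussState_coeFn ..).trans (.of_forall fun x => ?_)
  have hw : width a s 0 = ((a ^ 2 : ℝ) : ℂ) := by simp [width]
  have ha' : (a : ℂ) ≠ 0 := Complex.ofReal_ne_zero.2 ha.ne'
  have hpi : 0 < √Real.pi := Real.sqrt_pos.2 Real.pi_pos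
  -- The normalisation is moved into the exponent. At t = 0 the two k₀² terms of `exponentConst`
  -- cancel.
  have hn : ((1 / √(a * √Real.pi) : ℝ) : ℂ) =
      Complex.exp ((Real.log (a / √Real.pi) / 2 - Real.log (a ^ 2) / 2 : ℝ) : ℂ) := by
    rw [← Complex.ofReal_exp]
    congr 1
    rw [Real.log_div ha.ne' hpi.ne', Real.log_pow, one_div, ← Real.exp_log
      (Real.sqrt_pos.2 (mul_pos ha hpi)), ← Real.exp_neg, Real.log_sqrt (by positivity),
      Real.log_mul ha.ne' hpi.ne']
    congr 1
    push_cast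
    ring
  rw [gaussianPacket, hn, ← Complex.exp_add, polyGauss, exponentConst, exponentLin, exponentQuad,
    hw, ← Complex.ofReal_log (by positivity)]
  simp only [zero_mul, add_zero, one_mul]
  congr 1
  push_cast
  field_simp
  ring

-- Both sides become exponentials of real quadratics. The variance is |w|²/(2a²), and the centre
-- moves at the constant velocity k₀s/a.
open ProbabilityTheory in
theorem norm_packet_sq {v : NNReal} (hv : (v : ℝ) = (a ^ 4 + (s * t) ^ 2) / (2 * a ^ 2)) :
    ∀ᵐ x, ‖packet ha k₀ s t x‖ ^ 2 = gaussianPDFReal (k₀ * (s * t) / a) v x := by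
  filter_upwards [gaussState_coeFn 1 0 0 (exponentConst a k₀ s t) (exponentLin a k₀ s t)
    (exponentQuad_re_neg ha s t)] with x hx
  rw [packet, hx, polyGauss]
  simp only [zero_mul, add_zero, one_mul]
  rw [norm_exp_quadratic, ← Real.exp_nat_mul, gaussianPDFReal, hv]
  set n := a ^ 4 + (s * t) ^ 2 with hn
  have hn₀ : 0 < n := by positivity
  have hpi : 0 < √Real.pi := Real.sqrt_pos.2 Real.pi_pos
  have i₁ : (width a s t)⁻¹.re = a ^ 2 / n := by
    rw [Complex.inv_re, width_re, normSq_width]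
  have i₂ : (width a s t)⁻¹.im = -(s * t) / n := by
    rw [Complex.inv_im, width_im, normSq_width]
  have i₃ : ‖width a s t‖ = √n := by
    rw [hn, ← normSq_width, Complex.normSq_eq_norm_sq, Real.sqrt_sq (norm_nonneg _)]
  have r₁ : (exponentConst a k₀ s t).re = Real.log (a / √Real.pi) / 2 - k₀ ^ 2 / 2 -
      Real.log √n / 2 + (a * k₀) ^ 2 / 2 * (a ^ 2 / n) := by
    have h2 : ((a * k₀ : ℂ) ^ 2 / 2) = (((a * k₀) ^ 2 / 2 : ℝ) : ℂ) := by push_cast; rfl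
    rw [exponentConst, h2, Complex.add_re, Complex.sub_re, Complex.re_ofReal_mul, i₁,
      Complex.ofReal_re, Complex.div_ofNat_re, Complex.log_re, i₃]
  have r₂ : (exponentLin a k₀ s t).re = a * k₀ * (s * t) / n := by
    have h2 : exponentLin a k₀ s t = ((a * k₀ : ℝ) : ℂ) * (Complex.I * (width a s t)⁻¹) := by
      rw [exponentLin]; push_cast; ring
    rw [h2, Complex.re_ofReal_mul, Complex.I_mul_re, i₂]
    ring
  have r₃ : (exponentQuad a s t).re = -(1 / 2) * (a ^ 2 / n) := by
    have h2 : exponentQuad a s t = ((-(1 / 2) : ℝ) : ℂ) * (width a s t)⁻¹ := by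
      rw [exponentQuad]; push_cast; ring
    rw [h2, Complex.re_ofReal_mul, i₁]
  have hc : (√(2 * Real.pi * (n / (2 * a ^ 2))))⁻¹ =
      Real.exp (Real.log (a / √Real.pi) - Real.log √n) := by
    rw [Real.exp_sub, Real.exp_log (by positivity), Real.exp_log (by positivity),
      show 2 * Real.pi * (n / (2 * a ^ 2)) = Real.pi * n / a ^ 2 by field_simp,
      Real.sqrt_div (by positivity), Real.sqrt_sq ha.le, Real.sqrt_mul Real.pi_pos.le]
    field_simp
  rw [hc, ← Real.exp_add, r₁, r₂, r₃]
  congr 1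
  push_cast
  field_simp
  rw [hn]
  ring

end Packet

theorem exists_packet {ħ : ℝ} (hħ : 0 < ħ) {m : ℝ} (hm : 0 < m) (k₀ : ℝ) {v : ℝ × ℝ}
    (hv : v ∈ hyperbolicRegion ħ) :
    ∃ a : ℝ, 0 < a ∧ ∃ u : ℝ → L2, IsFreeEvolution ħ m u ∧
      (u 0 : ℝ → ℂ) =ᵐ[volume] gaussianPacket a k₀ ∧
      ∃ t : ℝ, 0 ≤ t ∧ ‖u t‖ = 1 ∧
        ∃ (hx : u t ∈ position.domain) (hp : u t ∈ (momentum ħ).domain),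
          v = (stdDev position ⟨u t, hx⟩, stdDev (momentum ħ) ⟨u t, hp⟩) := by
  obtain ⟨x, y⟩ := v
  obtain ⟨hxy, hx₀, hy₀⟩ := hv
  simp only at hxy hx₀ hy₀
  have h2 : 0 < √(2 : ℝ) := Real.sqrt_pos.2 two_pos
  -- Chosen so that the conserved Δp = ħ/(√2 a) equals y; then xy ≥ ħ/2 becomes a ≤ √2 x.
  obtain ⟨a, ha, hay⟩ : ∃ a : ℝ, 0 < a ∧ a * (√2 * y) = ħ :=
    ⟨ħ / (√2 * y), by positivity, div_mul_cancel₀ _ (by positivity)⟩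
  have hax : a ≤ √2 * x := by
    have h : a * (√2 * y) ≤ √2 * x * (√2 * y) := by
      rw [hay]
      calc ħ ≤ 2 * (x * y) := by linarith
        _ = √2 ^ 2 * (x * y) := by rw [Real.sq_sqrt zero_le_two]
        _ = _ := by ring
    exact le_of_mul_le_mul_right h (by positivity)
  have hax' : a ^ 2 ≤ 2 * x ^ 2 := by
    calc a ^ 2 ≤ (√2 * x) ^ 2 := by gcongr
      _ = 2 * x ^ 2 := by rw [mul_pow, Real.sq_sqrt zero_le_two]
  -- The solution t ≥ 0 of (a⁴ + (ħt/m)²)/(2a²) = x², when the spreading packet reaches Δx = x.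
  obtain ⟨t, ht₀, ht⟩ : ∃ t : ℝ, 0 ≤ t ∧ ħ / m * t = a * √(2 * x ^ 2 - a ^ 2) :=
    ⟨m / ħ * (a * √(2 * x ^ 2 - a ^ 2)), by positivity, by field_simp⟩
  have hn : a ^ 4 + (ħ / m * t) ^ 2 = 2 * a ^ 2 * x ^ 2 := by
    rw [ht, mul_pow, Real.sq_sqrt (sub_nonneg.2 hax')]
    ring
  obtain ⟨w, hw⟩ : ∃ w : NNReal, (w : ℝ) = x ^ 2 := ⟨⟨x ^ 2, sq_nonneg x⟩, rfl⟩
  have hw₀ : w ≠ 0 := by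
    rintro rfl
    exact (pow_pos hx₀ 2).ne hw
  have hpdf := norm_packet_sq ha k₀ (ħ / m) t (v := w) (by
    rw [hn, hw]
    field_simp)
  have hx : packet ha k₀ (ħ / m) t ∈ position.domain := gaussState_mem_position_domain
    (exponentConst a k₀ (ħ / m) t) (exponentLin a k₀ (ħ / m) t) (exponentQuad_re_neg ha (ħ / m) t)
  have hp : packet ha k₀ (ħ / m) t ∈ (momentum ħ).domain := gaussState_mem_momentum_domain ħ 1 0
    (exponentConst a k₀ (ħ / m) t) (exponentLin a k₀ (ħ / m) t)
    (exponentQuad_re_neg ha (ħ / m) t)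
  refine ⟨a, ha, packet ha k₀ (ħ / m), isFreeEvolution_packet ha k₀ hħ hm,
    packet_zero ha k₀ _, t, ht₀, norm_eq_one_of_gaussian hw₀ hpdf, hx, hp, ?_⟩
  have d₁ : stdDev position ⟨packet ha k₀ (ħ / m) t, hx⟩ = x := by
    rw [stdDev_position_of_gaussian hw₀ hpdf, hw, Real.sqrt_sq hx₀.le]
  have d₂ : stdDev (momentum ħ) ⟨packet ha k₀ (ħ / m) t, hp⟩ = y := by
    have hγ : ‖exponentQuad a (ħ / m) t‖ = 1 / (2 * (√2 * a * x)) := by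
      have e : ‖width a (ħ / m) t‖ = √2 * a * x := by
        rw [← Real.sqrt_sq (norm_nonneg (width a (ħ / m) t)), ← Complex.normSq_eq_norm_sq,
          normSq_width, hn, show 2 * a ^ 2 * x ^ 2 = 2 * (a * x) ^ 2 by ring,
          Real.sqrt_mul zero_le_two, Real.sqrt_sq (by positivity)]
        ring
      rw [exponentQuad, norm_mul, norm_inv, e]
      simp
      ring
    refine (stdDev_momentum_gaussState hħ _ hw₀ hpdf hp).trans ?_
    rw [hγ, hw, Real.sqrt_sq hx₀.le, ← hay]
    field_simp
  rw [d₁, d₂]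

theorem hyperbolicRegion_subset_pureRegion {ħ : ℝ} (hħ : 0 < ħ) :
    hyperbolicRegion ħ ⊆ pureRegion position (momentum ħ) := by
  intro v hv
  obtain ⟨a, -, u, -, -, t, -, h, hx, hp, e⟩ := exists_packet hħ one_pos 0 hv
  exact ⟨u t, h, hx, hp, e⟩

end UncertaintyRegion

theorem theorem3 (ħ : ℝ) (hħ : 0 < ħ) :
    UncertaintyRegion.pureRegion UncertaintyRegion.position (UncertaintyRegion.momentum ħ) =
      UncertaintyRegion.mixedRegion UncertaintyRegion.position (UncertaintyRegion.momentum ħ) ∧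
    UncertaintyRegion.mixedRegion UncertaintyRegion.position (UncertaintyRegion.momentum ħ) =
      UncertaintyRegion.hyperbolicRegion ħ ∧
    ∀ m : ℝ, 0 < m → ∀ k₀ : ℝ, ∀ v ∈ UncertaintyRegion.hyperbolicRegion ħ,
      ∃ a : ℝ, 0 < a ∧ ∃ u : ℝ → UncertaintyRegion.L2,
        UncertaintyRegion.IsFreeEvolution ħ m u ∧
        (u 0 : ℝ → ℂ) =ᵐ[volume] UncertaintyRegion.gaussianPacket a k₀ ∧
        ∃ t : ℝ, 0 ≤ t ∧ ‖u t‖ = 1 ∧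
          ∃ (hx : u t ∈ UncertaintyRegion.position.domain)
            (hp : u t ∈ (UncertaintyRegion.momentum ħ).domain),
            v = (UncertaintyRegion.stdDev UncertaintyRegion.position ⟨u t, hx⟩,
              UncertaintyRegion.stdDev (UncertaintyRegion.momentum ħ) ⟨u t, hp⟩) := by
  have h₁ := UncertaintyRegion.pureRegion_subset_mixedRegion
    (fun _ h => UncertaintyRegion.im_inner_position h)
    (fun _ h => UncertaintyRegion.im_inner_momentum (ħ := ħ) h)
  have h₂ := UncertaintyRegion.mixedRegion_subset_hyperbolicRegion hħ
  have h₃ := UncertaintyRegion.hyperbolicRegion_subset_pureRegion hħ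
  exact ⟨h₁.antisymm (h₂.trans h₃), h₂.antisymm (h₃.trans h₁),
    fun _ hm k₀ _ hv => UncertaintyRegion.exists_packet hħ hm k₀ hv⟩
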